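/- A singular hybrid automaton (SHA) consists of a finite set $M$ of modes with a set $M_0\subseteq M$ of initial modes, a finite set $\Sigma$ of actions, a finite set $X$ of real-valued variables, a finite set $\Delta$ of transitions $(m,G,a,R,m')$ (source mode, guard, action, set of variables reset to $0$, target mode) in which each action occurs at most once, an invariant $I(m)$ and a rate vector $F(m)\in\mathbb{Q}^X$ for each mode $m$; guards and invariants are finite conjunctions of linear constraints $\sum_i a_i x_i \bowtie k$ with $a_i,k\in\mathbb{Z}$ and $\bowtie\in\{<,\le,=,\ge,>\}$. A variable is a clock if its rate is $1$ in every mode. A configuration is a pair $(m,\nu)$ with $\nu\in\mathbb{R}^X$ satisfying $I(m)$; a step $(m,\nu)\xrightarrow{t}_a(m',\nu')$ between configurations, $t\ge 0$, lets the time $t$ elapse with $\nu+\tau F(m)$ satisfying $I(m)$ for all $\tau\in[0,t]$, and then takes a transition $(m,G,a,R,m')\in\Delta$ with $\nu+tF(m)$ satisfying $G$ and $\nu'=(\nu+tF(m))[R:=0]$. An infinite run is non-Zeno if the sum of its delays diverges. CTL formulas (built from $\top$, $\bot$, atomic propositions, $\neg$, $\wedge$, $\mathbf{E}\bigcirc$,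 $\mathbf{A}\bigcirc$, $\mathbf{E}\,\mathcal{U}$, $\mathbf{A}\,\mathcal{U}$) are interpreted over configurations in the standard way, where atomic propositions are read off a labelling of the modes, the path quantifiers range over the non-Zeno infinite runs from the given configuration, and the positions of a run are the configurations reached after its successive steps. The CTL model-checking problem for SHA takes as input an SHA, a rational starting valuation $\nu_0$ which satisfies the invariants of all initial modes, a finite set of atomic propositions with a labelling of the modes by sets of propositions, and a CTL formula $\phi$, and asks whether $(m_0,\nu_0)\models\phi$ for every initial mode $m_0\in M_0$. **Theorem.** The CTL model-checking problem is undecidable for singular hybrid automata with exactly two variables, one of which is a clock. -/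

import Mathlib

namespace Hybrid

/-- The comparison symbols allowed in linear constraints. -/
inductive Rel where
  | lt | le | eq | ge | gt

/-- The meaning of a comparison symbol on the reals. -/
def Rel.Holds : Rel → ℝ → ℝ → Prop
  | .lt, a, b => a < b
  | .le, a, b => a ≤ b
  | .eq, a, b => a = b
  | .ge, a, b => a ≥ b
  | .gt, a, b => a > b

/-- A linear constraint `∑ x, coeff x * x ⋈ bound` with integer coefficients and bound. -/
structure LinConstraint (X : Type) where
  coeff : X → ℤ
  rel : Rel
  bound : ℤ

/-- The linear constraint holds in the valuation `ν`. -/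
def LinConstraint.Holds {X : Type} [Fintype X] (g : LinConstraint X) (ν : X → ℝ) : Prop :=
  g.rel.Holds (∑ x, (g.coeff x : ℝ) * ν x) (g.bound : ℝ)

/-- A polyhedral constraint: a finite conjunction of linear constraints. The empty conjunction
is `⊤`, and the conjunction of the single constraint `0 < 0` is `⊥`. -/
abbrev Poly (X : Type) : Type := List (LinConstraint X)

/-- The set of valuations that satisfy a polyhedral constraint. -/
def Poly.sem {X : Type} [Fintype X] (G : Poly X) : Set (X → ℝ) :=
  {ν | ∀ g ∈ G, g.Holds ν}

/-- A transition `(m, G, a, R, m')`: source mode, guard, action, set of variables that are reset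
to `0`, target mode. -/
structure Transition (M A X : Type) where
  src : M
  guard : Poly X
  act : A
  reset : Finset X
  tgt : M

/-- A singular hybrid automaton with modes `M`, actions `A` and variables `X`. The transition
relation is given by the list of its elements; an action determines its transition. -/
structure SHA (M A X : Type) where
  init : Finset M
  trans : List (Transition M A X)
  inv : M → Poly X
  flow : M → X → ℚ
  act_unique : ∀ δ ∈ trans, ∀ δ' ∈ trans, δ.act = δ'.act → δ = δ'

/-- A state of an automaton: a mode together with a valuation. -/
abbrev State (M X : Type) : Type := M × (X → ℝ)

namespace SHA

variable {M A X : Type}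

/-- The variable `y` is a clock: it has rate `1` in every mode. -/
def IsClock (H : SHA M A X) (y : X) : Prop :=
  ∀ m, H.flow m y = 1

/-- The valuation reached from `ν` after `t` time units in mode `m`. -/
def after (H : SHA M A X) (m : M) (ν : X → ℝ) (t : ℝ) : X → ℝ :=
  fun x => ν x + t * (H.flow m x : ℝ)

variable [Fintype X]

/-- The configurations are the states whose valuation satisfies the invariant of the mode. -/
def IsConfig (H : SHA M A X) (c : State M X) : Prop :=
  c.2 ∈ (H.inv c.1).sem

open Classical in
/-- `H.Step c t a c'`: from the configuration `c` the automaton can wait for `t` time units and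
then take a transition with action `a` to the configuration `c'`. -/
def Step (H : SHA M A X) (c : State M X) (t : ℝ) (a : A) (c' : State M X) : Prop :=
  0 ≤ t ∧ H.IsConfig c ∧ H.IsConfig c' ∧
    ∃ δ ∈ H.trans, δ.src = c.1 ∧ δ.act = a ∧ δ.tgt = c'.1 ∧
      (∀ τ ∈ Set.Icc 0 t, H.after c.1 c.2 τ ∈ (H.inv c.1).sem) ∧
      H.after c.1 c.2 t ∈ δ.guard.sem ∧
      c'.2 = fun x => if x ∈ δ.reset then 0 else H.after c.1 c.2 t x

/-- An infinite run from an arbitrary configuration: `(conf 0) (delay 0, act 0) (conf 1) …`. -/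
structure Run (H : SHA M A X) where
  conf : ℕ → State M X
  delay : ℕ → ℝ
  act : ℕ → A
  step : ∀ i, H.Step (conf i) (delay i) (act i) (conf (i + 1))

/-- A run is non-Zeno if the sum of its (nonnegative) delays diverges. -/
def Run.NonZeno {H : SHA M A X} (r : H.Run) : Prop :=
  ¬ Summable r.delay

end SHA

/-- Formulas of computation tree logic over the atomic propositions `P`. -/
inductive CTL (P : Type) where
  | top : CTL P
  | bot : CTL P
  | atom : P → CTL P
  | neg : CTL P → CTL P
  | and : CTL P → CTL P → CTL P
  | EX : CTL P → CTL P
  | AX : CTL P → CTL P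
  | EU : CTL P → CTL P → CTL P
  | AU : CTL P → CTL P → CTL P

/-- Satisfaction of a CTL formula in a state. The path quantifiers range over the non-Zeno
infinite runs from the state; a position of a run is the configuration after finitely many
discrete transitions, and atomic propositions are read off its mode. -/
def SHA.Sat {M A X P : Type} [Fintype X] (H : SHA M A X) (L : M → Finset P) :
    CTL P → State M X → Prop
  | .top, _ => True
  | .bot, _ => False
  | .atom p, c => p ∈ L c.1
  | .neg φ, c => ¬ H.Sat L φ c
  | .and φ ψ, c => H.Sat L φ c ∧ H.Sat L ψ c
  | .EX φ, c => ∃ r : H.Run, r.conf 0 = c ∧ r.NonZeno ∧ H.Sat L φ (r.conf 1)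
  | .AX φ, c => ∀ r : H.Run, r.conf 0 = c → r.NonZeno → H.Sat L φ (r.conf 1)
  | .EU φ ψ, c => ∃ r : H.Run, r.conf 0 = c ∧ r.NonZeno ∧
      ∃ i, H.Sat L ψ (r.conf i) ∧ ∀ j < i, H.Sat L φ (r.conf j)
  | .AU φ ψ, c => ∀ r : H.Run, r.conf 0 = c → r.NonZeno →
      ∃ i, H.Sat L ψ (r.conf i) ∧ ∀ j < i, H.Sat L φ (r.conf j)

/-- An instance of the CTL model-checking problem for singular hybrid automata with `d`
variables: an automaton with finitely many modes and actions, a rational starting valuation (that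
forms a configuration with each initial mode), a finite set of atomic propositions, a labelling of
the modes with sets of propositions, and a CTL formula. -/
structure MCInstance (d : ℕ) where
  numModes : ℕ
  numActs : ℕ
  numProps : ℕ
  aut : SHA (Fin numModes) (Fin numActs) (Fin d)
  start : Fin d → ℚ
  lab : Fin numModes → Finset (Fin numProps)
  formula : CTL (Fin numProps)
  start_config : ∀ m ∈ aut.init, aut.IsConfig (m, fun x => (start x : ℝ))

/-- The answer to the instance is yes: every initial mode, with the starting valuation, satisfies
the formula. -/
def MCInstance.Holds {d : ℕ} (I : MCInstance d) : Prop :=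
  ∀ m ∈ I.aut.init, I.aut.Sat I.lab I.formula (m, fun x => (I.start x : ℝ))

/-! ### Instances as finite data -/

/-- An integer is written as its sign and its absolute value. -/
abbrev IntCode : Type := Bool × ℕ

def codeInt (z : ℤ) : IntCode := (decide (z < 0), z.natAbs)

/-- A rational number is written as its numerator and its denominator in lowest terms. -/
abbrev RatCode : Type := IntCode × ℕ

def codeRat (q : ℚ) : RatCode := (codeInt q.num, q.den)

/-- A set of indices below `n` is written as its characteristic list of length `n`. -/
def codeFinset {n : ℕ} (s : Finset (Fin n)) : List Bool :=
  List.ofFn fun i => decide (i ∈ s)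

def codeRel : Rel → ℕ
  | .lt => 0
  | .le => 1
  | .eq => 2
  | .ge => 3
  | .gt => 4

/-- Coefficients, comparison symbol, bound. -/
abbrev ConstraintCode : Type := List IntCode × ℕ × IntCode

def codeConstraint {d : ℕ} (g : LinConstraint (Fin d)) : ConstraintCode :=
  (List.ofFn fun x => codeInt (g.coeff x), codeRel g.rel, codeInt g.bound)

abbrev PolyCode : Type := List ConstraintCode

def codePoly {d : ℕ} (G : Poly (Fin d)) : PolyCode :=
  G.map codeConstraint

/-- Source, guard, action, reset set, target. -/
abbrev TransitionCode : Type := ℕ × PolyCode × ℕ × List Bool × ℕ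

def codeTransition {n s d : ℕ} (δ : Transition (Fin n) (Fin s) (Fin d)) : TransitionCode :=
  (δ.src, codePoly δ.guard, δ.act, codeFinset δ.reset, δ.tgt)

/-- Initial modes, transitions, invariants of the modes, rates in the modes. -/
abbrev SHACode : Type :=
  List Bool × List TransitionCode × List PolyCode × List (List RatCode)

def codeSHA {n s d : ℕ} (H : SHA (Fin n) (Fin s) (Fin d)) : SHACode :=
  (codeFinset H.init, H.trans.map codeTransition,
    List.ofFn fun m => codePoly (H.inv m),
    List.ofFn fun m => List.ofFn fun x => codeRat (H.flow m x))

/-- A formula is written in Polish (prefix) notation. -/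
def codeCTL {p : ℕ} : CTL (Fin p) → List ℕ
  | .top => [0]
  | .bot => [1]
  | .atom i => [2, i]
  | .neg φ => 3 :: codeCTL φ
  | .and φ ψ => 4 :: (codeCTL φ ++ codeCTL ψ)
  | .EX φ => 5 :: codeCTL φ
  | .AX φ => 6 :: codeCTL φ
  | .EU φ ψ => 7 :: (codeCTL φ ++ codeCTL ψ)
  | .AU φ ψ => 8 :: (codeCTL φ ++ codeCTL ψ)

/-- Numbers of modes, actions and propositions; automaton; starting valuation; labelling;
formula. -/
abbrev MCCode : Type :=
  (ℕ × ℕ × ℕ) × SHACode × List RatCode × List (List Bool) × List ℕ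

def MCInstance.code {d : ℕ} (I : MCInstance d) : MCCode :=
  ((I.numModes, I.numActs, I.numProps), codeSHA I.aut,
    List.ofFn fun x => codeRat (I.start x),
    List.ofFn fun m => codeFinset (I.lab m),
    codeCTL I.formula)

/-- The decision problem "does `Q I` hold?" for inputs `I` with the property `D`, presented through
the encoding `code` of inputs as finite data, is decidable: some computable Boolean function of the
code answers it correctly on every such input. -/
def DecidableOn {α β : Type} [Primcodable β] (code : α → β) (D Q : α → Prop) : Prop :=
  ∃ f : β → Bool, Computable f ∧ ∀ I, D I → (f (code I) = true ↔ Q I)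

end Hybrid

/-! The halting problem reduces to the model-checking problem. A partial recursive function is
computed by a flow chart over counter registers, and the registers are packed into one Gödel number
`y`, a product of prime powers. Each instruction then tests a remainder of `y` and multiplies `y` by
a fixed fraction (`Register.exists_chart_of_partrec`).

The automaton keeps `y` in its second variable and starts every phase with clock value `0`. If `y`
grows at rate `mul - div` and the mode is left when `y = mul * x`, the elapsed time is `y / div`, so
`y` has become `y * mul / div`. A remainder test subtracts the modulus once per time unit and so
destroys `y`. This is where branching time is needed: the test runs on a side branch, demanded by an
`EX` subformula at each node, while the main branch keeps `y`
(`Register.Chart.sat_testFormula_iff`). An `EU` formula then says that the last node is reachable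
with all tests passed (`Register.Chart.sat_haltFormula_iff`). A sink that loops with delay `1`
supplies the non-Zeno continuations.

The chart is taken for a universal function, so automaton and formula are fixed and only the
starting value `2 ^ n` varies. -/

open Function Relation

/-! ### Register programs compute all partial recursive functions. -/

namespace Register

/-- Elementary instructions of a machine whose registers are indexed by `ℕ`. -/
inductive Op where
  | nop
  | inc (i : ℕ)
  | dec (i : ℕ)
  | zero (i : ℕ)

/-- The effect of an instruction on the registers; `dec` blocks on `0`, and `zero` is a test. -/
def Op.Rel : Op → (ℕ → ℕ) → (ℕ → ℕ) → Prop
  | .nop, s, s' => s' = s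
  | .inc i, s, s' => s' = update s i (s i + 1)
  | .dec i, s, s' => s i ≠ 0 ∧ s' = update s i (s i - 1)
  | .zero i, s, s' => s i = 0 ∧ s' = s

/-- The relations on register contents that regular programs over the instructions define. -/
inductive Prog : ((ℕ → ℕ) → (ℕ → ℕ) → Prop) → Prop
  | op (o : Op) : Prog o.Rel
  | comp {R T} : Prog R → Prog T → Prog (Comp R T)
  | star {R} : Prog R → Prog (ReflTransGen R)

/-- While register `c` is nonzero, decrement it and execute `B`. -/
def While (c : ℕ) (B : (ℕ → ℕ) → (ℕ → ℕ) → Prop) : (ℕ → ℕ) → (ℕ → ℕ) → Prop :=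
  Comp (ReflTransGen (Comp (Op.dec c).Rel B)) (Op.zero c).Rel

theorem Prog.while {c B} (hB : Prog B) : Prog (While c B) :=
  ((Prog.op _).comp hB).star.comp (.op _)

theorem comp_iff {R T : (ℕ → ℕ) → (ℕ → ℕ) → Prop} {s x s'} (h : ∀ u, R s u ↔ u = x) :
    Comp R T s s' ↔ T x s' := by
  simp [Comp, h]

/-- Soundness is an induction on the iterations performed. Only the converse needs the measure `μ`.
It may depend on the final state `s'`, because an unbounded search has no bound that is visible from
the current state alone. -/
theorem while_iff {c : ℕ} {B P : (ℕ → ℕ) → (ℕ → ℕ) → Prop} {I : (ℕ → ℕ) → Prop}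
    (μ : (ℕ → ℕ) → (ℕ → ℕ) → ℕ)
    (h0 : ∀ s, I s → s c = 0 → ∀ s', P s s' ↔ s' = s)
    (h1 : ∀ s, I s → s c ≠ 0 → ∃ t, (∀ s', B (update s c (s c - 1)) s' ↔ s' = t) ∧ I t ∧
      ∀ s', (P s s' ↔ P t s') ∧ (P s s' → μ t s' < μ s s')) (s : ℕ → ℕ) (hs : I s)
    (s' : ℕ → ℕ) : While c B s s' ↔ P s s' := by
  constructor
  · rintro ⟨u, hu, hz, rfl⟩
    induction hu using ReflTransGen.head_induction_on with
    | refl => exact (h0 _ hs hz _).2 rfl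
    | head h _ ih =>
      obtain ⟨_, ⟨hc, rfl⟩, hB⟩ := h
      obtain ⟨t, ht, hI, hP⟩ := h1 _ hs hc
      obtain rfl := (ht _).1 hB
      exact (hP _).1.2 (ih hI)
  · induction hk : μ s s' using Nat.strong_induction_on generalizing s with
    | _ k ih =>
      intro hP
      by_cases hc : s c = 0
      · obtain rfl := (h0 _ hs hc _).1 hP
        exact ⟨_, .refl, hc, rfl⟩
      · obtain ⟨t, ht, hI, h⟩ := h1 _ hs hc
        obtain ⟨u, hu, hz⟩ := ih _ (hk ▸ (h s').2 hP) t hI rfl ((h s').1.1 hP)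
        exact ⟨u, .head ⟨_, ⟨hc, rfl⟩, (ht _).2 rfl⟩ hu, hz⟩

/-- A loop that decreases its counter: `F` is the function computed by the loop. -/
theorem for_iff {c : ℕ} {B : (ℕ → ℕ) → (ℕ → ℕ) → Prop} {I : (ℕ → ℕ) → Prop}
    (F : (ℕ → ℕ) → (ℕ → ℕ)) (h0 : ∀ s, I s → s c = 0 → F s = s)
    (h1 : ∀ s, I s → s c ≠ 0 → ∃ t, (∀ s', B (update s c (s c - 1)) s' ↔ s' = t) ∧ I t ∧
      t c < s c ∧ F t = F s) (s : ℕ → ℕ) (hs : I s) (s' : ℕ → ℕ) :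
    While c B s s' ↔ s' = F s := by
  refine while_iff (P := fun s s' => s' = F s) (I := I) (fun s _ => s c) ?_ ?_ s hs s'
  · intro s hs hc s'
    rw [h0 s hs hc]
  · intro s hs hc
    obtain ⟨t, ht, hI, hlt, hF⟩ := h1 s hs hc
    exact ⟨t, ht, hI, fun s' => ⟨by rw [hF], fun _ => hlt⟩⟩

/-- Set register `c` to `0`. -/
def clear (c : ℕ) : (ℕ → ℕ) → (ℕ → ℕ) → Prop :=
  While c Op.nop.Rel

theorem prog_clear (c : ℕ) : Prog (clear c) :=
  (Prog.op _).while

theorem clear_iff (c : ℕ) (s s' : ℕ → ℕ) : clear c s s' ↔ s' = update s c 0 := by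
  refine for_iff (I := fun _ => True) (fun s => update s c 0) ?_ ?_ s trivial s'
  · intro s _ h
    rw [← h, update_eq_self]
  · intro s _ h
    exact ⟨_, fun s' => Iff.rfl, trivial, by simp; omega, by simp⟩

/-- Copy register `a` to register `o`, with the scratch register `t`. -/
def copy (a o t : ℕ) : (ℕ → ℕ) → (ℕ → ℕ) → Prop :=
  Comp (clear o) (Comp (While a (Comp (Op.inc o).Rel (Op.inc t).Rel)) (While t (Op.inc a).Rel))

theorem prog_copy (a o t : ℕ) : Prog (copy a o t) :=
  (prog_clear o).comp ((((Prog.op _).comp (.op _)).while).comp (Prog.op _).while)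

theorem copy_iff {a o t : ℕ} (hao : a ≠ o) (hta : t ≠ a) (hto : t ≠ o) {s : ℕ → ℕ}
    (hs : s t = 0) (s' : ℕ → ℕ) : copy a o t s s' ↔ s' = update s o (s a) := by
  have h1 : ∀ s s', While a (Comp (Op.inc o).Rel (Op.inc t).Rel) s s' ↔
      s' = update (update (update s o (s o + s a)) t (s t + s a)) a 0 := by
    intro s s'
    refine for_iff (I := fun _ => True)
      (fun s => update (update (update s o (s o + s a)) t (s t + s a)) a 0) ?_ ?_ s trivial s'
    · intro s _ h
      ext j
      simp only [update_apply]
      split_ifs <;> simp_all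
    · intro s _ h
      refine ⟨_, fun s' => comp_iff fun u => Iff.rfl, trivial, ?_, ?_⟩
      · simp only [update_of_ne hta.symm, update_of_ne hao, update_self]
        omega
      · ext j
        simp only [update_apply]
        split_ifs <;> simp_all <;> omega
  have h2 : ∀ s s', While t (Op.inc a).Rel s s' ↔
      s' = update (update s a (s a + s t)) t 0 := by
    intro s s'
    refine for_iff (I := fun _ => True) (fun s => update (update s a (s a + s t)) t 0)
      ?_ ?_ s trivial s'
    · intro s _ h
      ext j
      simp only [update_apply]
      split_ifs <;> simp_all
    · intro s _ h
      refine ⟨_, fun s' => Iff.rfl, trivial, ?_, ?_⟩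
      · rw [update_of_ne hta, update_self]
        omega
      · ext j
        rcases eq_or_ne j t with rfl | hjt
        · simp
        rcases eq_or_ne j a with rfl | hja
        · simp [hjt, hjt.symm]
          omega
        · simp [hja, hjt]
  rw [copy, comp_iff (clear_iff o s), comp_iff (h1 _), h2]
  apply Eq.congr_right
  ext j
  rcases eq_or_ne j t with rfl | hjt
  · simp [hto, hs]
  rcases eq_or_ne j a with rfl | hja
  · simp [hao, hjt, hjt.symm, hto, hs]
  rcases eq_or_ne j o with rfl | hjo
  · simp [hja, hjt, hja.symm]
  · simp [hja, hjt, hjo]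

/-- All registers from `b` on are `0`. -/
def Clean (b : ℕ) (s : ℕ → ℕ) : Prop :=
  ∀ r, b ≤ r → s r = 0

/-- `f` is computed by programs with arbitrary argument registers `args` and output register `o`
that use only registers from `b` on as scratch space. -/
def Computes {n : ℕ} (f : List.Vector ℕ n →. ℕ) : Prop :=
  ∀ (args : Fin n → ℕ) (o b : ℕ), (∀ i, args i < b) → (∀ i, args i ≠ o) → o < b →
    ∃ R, Prog R ∧ ∀ s, Clean b s → ∀ s', R s s' ↔
      ∃ v ∈ f (List.Vector.ofFn fun i => s (args i)), s' = update s o v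

theorem mem_mOfFn {n : ℕ} (g : Fin n → Part ℕ) (w : List.Vector ℕ n) :
    w ∈ List.Vector.mOfFn g ↔ ∀ i, w.get i ∈ g i := by
  induction n with
  | zero =>
    simp only [List.Vector.mOfFn, Part.pure_eq_some, Part.mem_some_iff]
    exact ⟨fun _ i => i.elim0, fun _ => Subsingleton.elim _ _⟩
  | succ n ih =>
    simp only [List.Vector.mOfFn, Part.bind_eq_bind, Part.mem_bind_iff, Part.pure_eq_some,
      Part.mem_some_iff, ih, Fin.forall_fin_succ]
    constructor
    · rintro ⟨a, ha, v, hv, rfl⟩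
      simpa using ⟨ha, hv⟩
    · rintro ⟨h, h'⟩
      exact ⟨_, h, w.tail, fun i => by simpa using h' i, by
        rw [List.Vector.get_zero, List.Vector.cons_head_tail]⟩

/-- The values go to the registers from `b` on, and each program gets its scratch space from `b + n`
on. They are recorded by a function on `ℕ`, unconstrained beyond `k`, so that the induction on `k`
does not change types. -/
theorem exists_prog_list {m n : ℕ} {g : Fin n → List.Vector ℕ m →. ℕ} (hg : ∀ i, Computes (g i))
    {args : Fin m → ℕ} {b : ℕ} (ha : ∀ i, args i < b) {k : ℕ} (hk : k ≤ n) :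
    ∃ R, Prog R ∧ ∀ s, Clean b s → ∀ s', R s s' ↔
      ∃ w : ℕ → ℕ, (∀ i : Fin n, i < k → w i ∈ g i (List.Vector.ofFn fun i => s (args i))) ∧
        s' = fun r => if b ≤ r ∧ r < b + k then w (r - b) else s r := by
  induction k with
  | zero =>
    refine ⟨_, .op .nop, fun s _ s' => ?_⟩
    have : ∀ r, ¬ (b ≤ r ∧ r < b + 0) := by omega
    simp only [Op.Rel, this, if_false]
    simp
  | succ k ih =>
    obtain ⟨R, hR, h⟩ := ih (by omega)
    obtain ⟨T, hT, h'⟩ := hg ⟨k, hk⟩ args (b + k) (b + n)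
      (fun i => (ha i).trans_le (by omega)) (fun i => by have := ha i; omega) (by omega)
    refine ⟨_, hR.comp hT, fun s hs s' => ?_⟩
    have key : ∀ w : ℕ → ℕ, ∀ u, u = (fun r => if b ≤ r ∧ r < b + k then w (r - b) else s r) →
        (T u s' ↔ ∃ v ∈ g ⟨k, hk⟩ (List.Vector.ofFn fun i => s (args i)),
          s' = fun r => if b ≤ r ∧ r < b + (k + 1) then update w k v (r - b) else s r) := by
      rintro w u rfl
      rw [h' _ (fun r hr => by simp only [if_neg (show ¬ (b ≤ r ∧ r < b + k) by omega)]
                               exact hs _ (by omega))]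
      have e : ∀ i, ¬ (b ≤ args i ∧ args i < b + k) := fun i => by have := ha i; omega
      simp only [e, if_false]
      refine exists_congr fun v => and_congr_right fun _ => Eq.congr_right ?_
      ext r
      simp only [update_apply]
      split_ifs <;> first | rfl | omega
    constructor
    · rintro ⟨u, hu, hu'⟩
      obtain ⟨w, hw, e⟩ := (h s hs u).1 hu
      obtain ⟨v, hv, e'⟩ := (key w u e).1 hu'
      refine ⟨_, fun i hi => ?_, e'⟩
      rcases (Nat.lt_succ_iff_lt_or_eq.1 hi) with hi | hi
      · rw [update_of_ne hi.ne]
        exact hw i hi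
      · obtain rfl : i = ⟨k, hk⟩ := Fin.ext hi
        simpa using hv
    · rintro ⟨w, hw, e⟩
      refine ⟨_, (h s hs _).2 ⟨w, fun i hi => hw i (by omega), rfl⟩,
        (key w _ rfl).2 ⟨w k, hw ⟨k, hk⟩ (by simp), ?_⟩⟩
      rwa [update_eq_self]

theorem exists_prog_clear (b k : ℕ) : ∃ R, Prog R ∧ ∀ s s', R s s' ↔
    s' = fun r => if b ≤ r ∧ r < b + k then 0 else s r := by
  induction k with
  | zero =>
    refine ⟨_, .op .nop, fun s s' => ?_⟩
    have : ∀ r, ¬ (b ≤ r ∧ r < b + 0) := by omega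
    simp only [Op.Rel, this, if_false]
  | succ k ih =>
    obtain ⟨R, hR, h⟩ := ih
    refine ⟨_, hR.comp (prog_clear (b + k)), fun s s' => ?_⟩
    rw [comp_iff (h s), clear_iff]
    apply Eq.congr_right
    ext r
    simp only [update_apply]
    split_ifs <;> first | rfl | omega

/-- After `f` has read the intermediate values they are erased. `Computes` demands that nothing but
the output register change, which is what lets programs be nested. -/
theorem Computes.comp {m n : ℕ} {f : List.Vector ℕ n →. ℕ} {g : Fin n → List.Vector ℕ m →. ℕ}
    (hf : Computes f) (hg : ∀ i, Computes (g i)) :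
    Computes fun v => (List.Vector.mOfFn fun i => g i v) >>= f := by
  intro args o b ha hao ho
  obtain ⟨R, hR, h⟩ := exists_prog_list hg ha le_rfl
  obtain ⟨T, hT, h'⟩ := hf (fun i => b + i) o (b + n) (by simp) (fun i => by omega) (by omega)
  obtain ⟨C, hC, hc⟩ := exists_prog_clear b n
  refine ⟨_, hR.comp (hT.comp hC), fun s hs s' => ?_⟩
  have key : ∀ w : ℕ → ℕ, Relation.Comp T C
      (fun r => if b ≤ r ∧ r < b + n then w (r - b) else s r) s' ↔
      ∃ v ∈ f (List.Vector.ofFn fun i => w i), s' = update s o v := by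
    intro w
    have e : ∀ i : Fin n, b + (i : ℕ) < b + n := by simp
    simp only [Relation.Comp, hc]
    have hcl : Clean (b + n) (fun r => if b ≤ r ∧ r < b + n then w (r - b) else s r) :=
      fun r hr => by
        simp only [if_neg (show ¬ (b ≤ r ∧ r < b + n) by omega)]
        exact hs _ (by omega)
    have e2 : ∀ v : ℕ, (fun r => if b ≤ r ∧ r < b + n then 0 else
        update (fun r => if b ≤ r ∧ r < b + n then w (r - b) else s r) o v r) = update s o v := by
      intro v
      ext r
      simp only [update_apply]
      split_ifs with h1 h2 <;> first | rfl | omega | exact (hs _ h1.1).symm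
    constructor
    · rintro ⟨u, hu, rfl⟩
      obtain ⟨v, hv, rfl⟩ := (h' _ hcl _).1 hu
      exact ⟨v, by simpa [e] using hv, e2 v⟩
    · rintro ⟨v, hv, rfl⟩
      exact ⟨_, (h' _ hcl _).2 ⟨v, by simpa [e] using hv, rfl⟩, (e2 v).symm⟩
  constructor
  · rintro ⟨u, hu, hu'⟩
    obtain ⟨w, hw, rfl⟩ := (h s hs u).1 hu
    obtain ⟨v, hv, rfl⟩ := (key w).1 hu'
    exact ⟨v, Part.mem_bind_iff.2 ⟨_, (mem_mOfFn _ _).2 fun i => by simpa using hw i i.2, hv⟩, rfl⟩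
  · rintro ⟨v, hv, rfl⟩
    obtain ⟨w, hw, hv⟩ := Part.mem_bind_iff.1 hv
    rw [mem_mOfFn] at hw
    -- The value `0` beyond `n` is never read.
    refine ⟨_, (h s hs _).2 ⟨fun i => if hi : i < n then w.get ⟨i, hi⟩ else 0,
      fun i _ => by simpa using hw i, rfl⟩,
      (key fun i => if hi : i < n then w.get ⟨i, hi⟩ else 0).2 ⟨v, ?_, rfl⟩⟩
    simpa only [Fin.is_lt, dite_true, Fin.eta, List.Vector.ofFn_get] using hv

theorem ofFn_cons {n : ℕ} (s : ℕ → ℕ) (a : ℕ) (args : Fin n → ℕ) :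
    (List.Vector.ofFn fun i => s ((Fin.cons a args : Fin (n + 1) → ℕ) i)) =
      s a ::ᵥ List.Vector.ofFn fun i => s (args i) :=
  rfl

/-- Register `b` counts the remaining rounds, `b + 1` the completed ones, and `o` holds the current
value of the recursion. Since `o` is itself an argument of `g`, the new value is first computed in
`b + 2` and then copied. -/
theorem Computes.prec {n : ℕ} {f : List.Vector ℕ n → ℕ} {g : List.Vector ℕ (n + 2) → ℕ}
    (hf : Computes (n := n) fun v => Part.some (f v))
    (hg : Computes (n := n + 2) fun v => Part.some (g v)) :
    Computes (n := n + 1) fun v =>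
      Part.some (v.head.rec (f v.tail) fun y IH => g (y ::ᵥ IH ::ᵥ v.tail)) := by
  intro args o b ha hao ho
  obtain ⟨R, hR, h⟩ := hf (fun i => args i.succ) o (b + 3) (fun i => (ha _).trans (by omega))
    (fun i => hao _) (by omega)
  obtain ⟨T, hT, h'⟩ := hg (Fin.cons (b + 1) (Fin.cons o fun i => args i.succ)) (b + 2) (b + 3)
    (by
      intro i
      refine Fin.cases (by simp) (fun i => Fin.cases ?_ (fun i => ?_) i) i
      · simp; omega
      · simp only [Fin.cons_succ]; exact (ha _).trans (by omega))
    (by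
      intro i
      refine Fin.cases (by simp) (fun i => Fin.cases ?_ (fun i => ?_) i) i
      · simp; omega
      · simp only [Fin.cons_succ]; have := ha i.succ; omega) (by omega)
  simp only [Part.mem_some_iff, exists_eq_left] at h h'
  let val : (ℕ → ℕ) → ℕ → ℕ := fun s k => k.rec (f (List.Vector.ofFn fun i => s (args i.succ)))
    fun y IH => g (y ::ᵥ IH ::ᵥ List.Vector.ofFn fun i => s (args i.succ))
  let I : (ℕ → ℕ) → Prop := fun s => Clean (b + 2) s ∧ s o = val s (s (b + 1)) ∧
    s (b + 1) + s b = s (args 0)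
  let F : (ℕ → ℕ) → (ℕ → ℕ) := fun s =>
    update (update (update s o (val s (s (args 0)))) (b + 1) (s (args 0))) b 0
  have ha' : ∀ i, args i ≠ b ∧ args i ≠ b + 1 ∧ args i ≠ b + 2 ∧ args i ≠ o := fun i => by
    have := ha i; have := hao i; omega
  let B := Relation.Comp T (Relation.Comp (copy (b + 2) o (b + 3))
    (Relation.Comp (clear (b + 2)) (Op.inc (b + 1)).Rel))
  have hB : Prog B := hT.comp ((prog_copy _ _ _).comp ((prog_clear _).comp (.op _)))
  have hW : ∀ s, I s → ∀ s', While b B s s' ↔ s' = F s := by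
    refine fun s hs s' => for_iff (I := I) F ?_ ?_ s hs s'
    · rintro s ⟨-, h2, h3⟩ hb
      ext r
      simp only [F, update_apply]
      split_ifs with h h h
      · rw [h, hb]
      · rw [h]; omega
      · rw [h, h2]; congr 1; omega
      · rfl
    · rintro s ⟨h1, h2, h3⟩ hb
      have hob : o ≠ b := by omega
      have hob1 : o ≠ b + 1 := by omega
      have hob2 : o ≠ b + 2 := by omega
      have hcl : Clean (b + 3) (update s b (s b - 1)) := fun r hr => by
        rw [update_of_ne (by omega)]
        exact h1 r (by omega)
      have hs3 : s (b + 3) = 0 := h1 _ (by omega)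
      have hs2 : s (b + 2) = 0 := h1 _ (by omega)
      have key : ∀ s', B (update s b (s b - 1)) s' ↔
          s' = update (update (update s b (s b - 1)) o (val s (s (b + 1) + 1))) (b + 1)
            (s (b + 1) + 1) := by
        intro s'
        simp only [B]
        rw [comp_iff (h' _ hcl), comp_iff (copy_iff (by omega) (by omega) (by omega) ?_),
          comp_iff (clear_iff _ _), Op.Rel]
        · apply Eq.congr_right
          rw [ofFn_cons, ofFn_cons]
          ext r
          simp only [update_apply, ha', if_false, hob, hob1.symm]
          split_ifs <;> first | omega | simp_all [val]
        · rw [update_of_ne (by omega), update_of_ne (by omega), hs3]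
      refine ⟨_, key, ⟨?_, ?_, ?_⟩, ?_, ?_⟩
      · intro r hr
        rw [update_of_ne (by omega), update_of_ne (by omega), update_of_ne (by omega)]
        exact h1 r hr
      · simp [val, ha', hob1]
      · simp [ha', hob.symm]
        omega
      · simp [hob.symm]
        omega
      · ext r
        simp only [F, val, update_apply, ha', if_false]
        split_ifs <;> rfl
  refine ⟨_, (prog_copy (args 0) b (b + 1)).comp (hR.comp ((hB.while (c := b)).comp
    (prog_clear (b + 1)))), fun s hs s' => ?_⟩
  have hb0 : s b = 0 := hs _ le_rfl
  have hb1 : s (b + 1) = 0 := hs _ (by omega)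
  rw [comp_iff (copy_iff (ha' 0).1 (ha' 0).2.1.symm (by omega) hb1), comp_iff (h _ ?_),
    comp_iff (hW _ ⟨?_, ?_, ?_⟩), clear_iff]
  · simp only [Part.mem_some_iff, exists_eq_left]
    apply Eq.congr_right
    ext r
    simp only [F, val, update_apply, ha', if_false]
    split_ifs <;> simp_all
  · intro r hr
    rw [update_of_ne (by omega), update_of_ne (by omega)]
    exact hs r (by omega)
  · simp [val, ha', hb1, show b + 1 ≠ o by omega]
  · simp [ha', hb1, ho.ne', show b + 1 ≠ o by omega]
  · intro r hr
    rw [update_of_ne (by omega)]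
    exact hs r (by omega)

theorem Computes.of_primrec' {n : ℕ} {f : List.Vector ℕ n → ℕ} (hf : Nat.Primrec' f) :
    Computes (n := n) fun v => Part.some (f v) := by
  induction hf with
  | zero =>
    intro args o b ha hao ho
    exact ⟨_, prog_clear o, fun s hs s' => by simp [clear_iff]⟩
  | succ =>
    intro args o b ha hao ho
    refine ⟨_, (prog_copy (args 0) o b).comp (.op (.inc o)), fun s hs s' => ?_⟩
    rw [comp_iff (copy_iff (hao 0) (ha 0).ne' ho.ne' (hs b le_rfl))]
    simp [Op.Rel, List.Vector.ofFn]
  | get i =>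
    intro args o b ha hao ho
    refine ⟨_, prog_copy (args i) o b, fun s hs s' => ?_⟩
    rw [copy_iff (hao i) (ha i).ne' ho.ne' (hs b le_rfl)]
    simp
  | comp g _ _ ihf ihg =>
    have := ihf.comp ihg
    simpa only [Part.bind_eq_bind, Vector.mOfFn_part_some, Part.bind_some] using this
  | prec _ _ ihf ihg => exact ihf.prec ihg

/-- Register `o` holds the candidate and `b` the value of `f` at it, so the loop on `b` stops
exactly at the first zero. The decrement built into the loop is harmless, since the body clears `b`
before recomputing it. -/
theorem Computes.rfind {n : ℕ} {f : List.Vector ℕ (n + 1) → ℕ}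
    (hf : Computes (n := n + 1) fun v => Part.some (f v)) :
    Computes (n := n) fun v => Nat.rfind fun k => Part.some (f (k ::ᵥ v) = 0 : Bool) := by
  intro args o b ha hao ho
  obtain ⟨R, hR, h⟩ := hf (Fin.cons o args) b (b + 1)
    (by
      intro i
      refine Fin.cases ?_ (fun i => ?_) i
      · simp; omega
      · simp only [Fin.cons_succ]; exact (ha _).trans (by omega))
    (by
      intro i
      refine Fin.cases ?_ (fun i => ?_) i
      · simp; omega
      · simp only [Fin.cons_succ]; exact (ha _).ne) (by omega)
  simp only [Part.mem_some_iff, exists_eq_left, ofFn_cons] at h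
  let val : (ℕ → ℕ) → ℕ → ℕ := fun s k => f (k ::ᵥ List.Vector.ofFn fun i => s (args i))
  let I : (ℕ → ℕ) → Prop := fun s => Clean (b + 1) s ∧ s b = val s (s o) ∧
    ∀ j < s o, val s j ≠ 0
  let P : (ℕ → ℕ) → (ℕ → ℕ) → Prop := fun s s' => ∃ m, (val s m = 0 ∧ ∀ j < m, val s j ≠ 0) ∧
    s' = update (update s o m) b 0
  have ha' : ∀ i, args i ≠ b ∧ args i ≠ o := fun i => ⟨(ha i).ne, hao i⟩
  have hW : ∀ s, I s → ∀ s', While b (Relation.Comp (clear b)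
      (Relation.Comp (Op.inc o).Rel R)) s s' ↔ P s s' := by
    -- In the final state `o` holds the least zero, so the distance to it counts the remaining
    -- rounds.
    refine fun s hs s' => while_iff (I := I) (fun s s' => s' o - s o) ?_ ?_ s hs s'
    · rintro s ⟨-, h2, h3⟩ hb s'
      rw [h2] at hb
      have e : update (update s o (s o)) b 0 = s := by
        rw [update_eq_self, ← hb, ← h2, update_eq_self]
      constructor
      · rintro ⟨m, ⟨hm, hm'⟩, rfl⟩
        obtain hlt | rfl | hlt := lt_trichotomy m (s o)
        · exact absurd hm (h3 _ hlt)
        · exact e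
        · exact absurd hb (hm' _ hlt)
      · rintro rfl
        exact ⟨s' o, ⟨hb, h3⟩, e.symm⟩
    · rintro s ⟨h1, h2, h3⟩ hb
      have hvb : val s (s o) ≠ 0 := h2 ▸ hb
      have key : ∀ s', Relation.Comp (clear b) (Relation.Comp (Op.inc o).Rel R)
          (update s b (s b - 1)) s' ↔
          s' = update (update s o (s o + 1)) b (val s (s o + 1)) := by
        intro s'
        rw [comp_iff (clear_iff _ _), comp_iff (fun u => Iff.rfl), h]
        · apply Eq.congr_right
          ext r
          simp only [update_apply, ha', if_false, ho.ne]
          split_ifs <;> first | omega | simp_all [val]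
        · intro r hr
          rw [update_of_ne (by omega), update_of_ne (by omega), update_of_ne (by omega)]
          exact h1 r hr
      have hval : ∀ j, val (update (update s o (s o + 1)) b (val s (s o + 1))) j = val s j := by
        intro j
        simp [val, ha']
      refine ⟨_, key, ⟨?_, ?_, ?_⟩, fun s' => ⟨?_, ?_⟩⟩
      · intro r hr
        rw [update_of_ne (by omega), update_of_ne (by omega)]
        exact h1 r hr
      · rw [hval]
        simp [ho.ne]
      · intro j hj
        rw [hval]
        rw [update_of_ne ho.ne, update_self, Nat.lt_succ_iff_lt_or_eq] at hj
        rcases hj with hj | rfl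
        exacts [h3 j hj, hvb]
      · simp only [P, hval]
        refine exists_congr fun m => and_congr_right fun _ => Eq.congr_right ?_
        ext r
        simp only [update_apply]
        split_ifs <;> rfl
      · rintro ⟨m, ⟨hm, hm'⟩, rfl⟩
        have : s o < m := by
          by_contra! hle
          rcases hle.lt_or_eq with hlt | rfl
          exacts [h3 _ hlt hm, hvb hm]
        simp only [update_of_ne ho.ne, update_self]
        omega
  refine ⟨_, (prog_clear o).comp (hR.comp (((prog_clear b).comp
    ((Prog.op (.inc o)).comp hR)).while (c := b))), fun s hs s' => ?_⟩
  have hcl : Clean (b + 1) (update s o 0) := fun r hr => by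
    rw [update_of_ne (by omega)]
    exact hs r (by omega)
  have hval : ∀ x, val (update (update s o 0) b x) = val s := by
    intro x
    ext j
    simp [val, ha']
  rw [comp_iff (clear_iff _ _), comp_iff (h _ hcl), hW _ ⟨?_, ?_, ?_⟩]
  · simp only [P, hval]
    refine exists_congr fun m => and_congr ?_ (Eq.congr_right ?_)
    · refine Iff.trans ?_ Nat.mem_rfind.symm
      simp [val]
    · ext r
      simp only [update_apply]
      split_ifs with h1 h2 <;> first | omega | rfl | simp_all [hs b le_rfl]
  · intro r hr
    rw [update_of_ne (by omega)]
    exact hcl r hr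
  · rw [hval]
    simp [val, ho.ne, ha']
  · simp [ho.ne]

theorem Computes.of_partrec' {n : ℕ} {f : List.Vector ℕ n →. ℕ} (hf : Nat.Partrec' f) :
    Computes f := by
  induction hf with
  | prim hf => exact .of_primrec' hf
  | comp g _ _ ihf ihg => exact ihf.comp ihg
  | rfind _ ihf => exact ihf.rfind

/-- The domain of a partial recursive function is the set of inputs, given in register `0`, on
which some program can terminate. -/
theorem exists_prog_of_partrec {f : ℕ →. ℕ} (hf : Partrec f) :
    ∃ R, Prog R ∧ ∀ n, (∃ s', R (update (fun _ => 0) 0 n) s') ↔ (f n).Dom := by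
  obtain ⟨R, hR, h⟩ := Computes.of_partrec' (Nat.Partrec'.part_iff₁.2 hf) (fun _ => 0) 1 2
    (by simp) (by simp) (by simp)
  refine ⟨R, hR, fun n => ?_⟩
  have hc : Clean 2 (update (fun _ => 0) 0 n) := fun r hr => by
    rw [update_of_ne (by omega)]
  simp only [h _ hc, Part.dom_iff_mem]
  simp [List.Vector.ofFn, List.Vector.head_cons]

end Register

/-! ### Flow charts for register programs. -/

namespace Register

/-- A flow chart: the nodes carry instructions, and after its instruction the control moves along
an edge. The last node carries no instruction. -/
structure Chart where
  Node : Type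
  [fin : Fintype Node]
  op : Node → Op
  next : Node → Node → Prop
  start : Node
  last : Node
  op_last : op last = .nop

attribute [instance] Chart.fin

/-- One step of a flow chart, where the instructions have the meaning `sem`. -/
def Chart.Step {S : Type} (C : Chart) (sem : Op → S → S → Prop) (c c' : C.Node × S) : Prop :=
  sem (C.op c.1) c.2 c'.2 ∧ C.next c.1 c'.1

/-- The flow chart defines the relation `R`. -/
def Chart.Defines (C : Chart) (R : (ℕ → ℕ) → (ℕ → ℕ) → Prop) : Prop :=
  ∀ s s', ReflTransGen (C.Step Op.Rel) (C.start, s) (C.last, s') ↔ R s s'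

/-- The flow chart that executes a single instruction. -/
def Chart.single (o : Op) : Chart where
  Node := Bool
  op b := cond b .nop o
  next b b' := b = false ∧ b' = true
  start := false
  last := true
  op_last := rfl

theorem Chart.single_defines (o : Op) : (Chart.single o).Defines o.Rel := by
  intro s s'
  constructor
  · intro h
    rcases h.cases_head with h | ⟨⟨q, t⟩, ⟨h, h'⟩, h''⟩
    · cases h
    · obtain ⟨-, rfl⟩ := h'
      rcases h''.cases_head with h'' | ⟨_, ⟨_, h'', _⟩, -⟩
      · cases h''
        exact h
      · cases h''
  · intro h
    exact .single ⟨h, rfl, rfl⟩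

/-- Sequential composition of flow charts. -/
def Chart.seq (C D : Chart) : Chart where
  Node := C.Node ⊕ D.Node
  op := Sum.elim C.op D.op
  next
    | .inl p, .inl q => C.next p q
    | .inl p, .inr q => p = C.last ∧ q = D.start
    | .inr _, .inl _ => False
    | .inr p, .inr q => D.next p q
  start := .inl C.start
  last := .inr D.last
  op_last := D.op_last

/-- There is no way back from the second chart to the first, so a path splits at its crossing. The
crossing leaves the registers alone because the last node of the first chart carries `nop`. -/
theorem Chart.seq_defines {C D : Chart} {R T} (hC : C.Defines R) (hD : D.Defines T) :
    (C.seq D).Defines (Relation.Comp R T) := by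
  intro s s'
  constructor
  · intro h
    have key : ∀ c : (C.seq D).Node × (ℕ → ℕ),
        ReflTransGen ((C.seq D).Step Op.Rel) c ((C.seq D).last, s') →
        (∀ q, c.1 = .inl q → ∃ t, ReflTransGen (C.Step Op.Rel) (q, c.2) (C.last, t) ∧
          ReflTransGen (D.Step Op.Rel) (D.start, t) (D.last, s')) ∧
        (∀ q, c.1 = .inr q → ReflTransGen (D.Step Op.Rel) (q, c.2) (D.last, s')) := by
      intro c hc
      induction hc using ReflTransGen.head_induction_on with
      | refl => exact ⟨fun q hq => (by cases hq), fun q hq => (by cases hq; exact .refl)⟩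
      | @head c c' h _ ih =>
        obtain ⟨c, u⟩ := c
        obtain ⟨c', u'⟩ := c'
        obtain ⟨h, h'⟩ := h
        constructor
        · rintro q ⟨⟩
          rcases c' with q' | q'
          · obtain ⟨t, ht, ht'⟩ := ih.1 q' rfl
            exact ⟨t, .head (b := (q', u')) ⟨h, h'⟩ ht, ht'⟩
          · obtain ⟨rfl, rfl⟩ := h'
            have h : (C.op C.last).Rel u u' := h
            rw [C.op_last] at h
            obtain rfl : u' = u := h
            exact ⟨u', .refl, ih.2 _ rfl⟩
        · rintro q ⟨⟩
          rcases c' with q' | q'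
          · exact h'.elim
          · exact .head (b := (q', u')) ⟨h, h'⟩ (ih.2 q' rfl)
    obtain ⟨t, h1, h2⟩ := (key _ h).1 _ rfl
    exact ⟨t, (hC _ _).1 h1, (hD _ _).1 h2⟩
  · rintro ⟨t, h1, h2⟩
    have e1 : ReflTransGen ((C.seq D).Step Op.Rel) (.inl C.start, s) (.inl C.last, t) :=
      ReflTransGen.lift (r := C.Step Op.Rel) (p := (C.seq D).Step Op.Rel)
        (fun c : C.Node × (ℕ → ℕ) => ((.inl c.1, c.2) : (C.seq D).Node × (ℕ → ℕ)))
        (fun _ _ h => h) _ _ ((hC _ _).2 h1)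
    have e2 : ReflTransGen ((C.seq D).Step Op.Rel) (.inr D.start, t) (.inr D.last, s') :=
      ReflTransGen.lift (r := D.Step Op.Rel) (p := (C.seq D).Step Op.Rel)
        (fun c : D.Node × (ℕ → ℕ) => ((.inr c.1, c.2) : (C.seq D).Node × (ℕ → ℕ)))
        (fun _ _ h => h) _ _ ((hD _ _).2 h2)
    have e : (C.seq D).Step Op.Rel (.inl C.last, t) (.inr D.start, t) :=
      ⟨by change (C.op C.last).Rel t t; rw [C.op_last]; rfl, rfl, rfl⟩
    exact e1.trans (.head e e2)

/-- Iteration of a flow chart, with an additional hub. -/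
def Chart.loop (C : Chart) : Chart where
  Node := Option C.Node
  op q := q.elim .nop C.op
  next
    | some p, some q => C.next p q
    | some p, none => p = C.last
    | none, some q => q = C.start
    | none, none => False
  start := none
  last := none
  op_last := rfl

/-- A path is cut at its visits to the hub; each piece in between is one execution of the inner
chart. -/
theorem Chart.loop_defines {C : Chart} {R} (hC : C.Defines R) :
    C.loop.Defines (ReflTransGen R) := by
  intro s s'
  constructor
  · intro h
    have key : ∀ c : C.loop.Node × (ℕ → ℕ),
        ReflTransGen (C.loop.Step Op.Rel) c (C.loop.last, s') →
        (c.1 = none → ReflTransGen R c.2 s') ∧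
        (∀ q, c.1 = some q → ∃ t, ReflTransGen (C.Step Op.Rel) (q, c.2) (C.last, t) ∧
          ReflTransGen R t s') := by
      intro c hc
      induction hc using ReflTransGen.head_induction_on with
      | refl => exact ⟨fun _ => .refl, fun q hq => (by cases hq)⟩
      | @head c c' h _ ih =>
        obtain ⟨c, u⟩ := c
        obtain ⟨c', u'⟩ := c'
        obtain ⟨h, h'⟩ := h
        constructor
        · rintro ⟨⟩
          obtain rfl : u' = u := h
          rcases c' with _ | q'
          · exact h'.elim
          · obtain rfl : q' = C.start := h'
            obtain ⟨t, ht, ht'⟩ := ih.2 _ rfl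
            exact .head ((hC _ _).1 ht) ht'
        · rintro q ⟨⟩
          rcases c' with _ | q'
          · obtain rfl : q = C.last := h'
            have h : (C.op C.last).Rel u u' := h
            rw [C.op_last] at h
            obtain rfl : u' = u := h
            exact ⟨u', .refl, ih.1 rfl⟩
          · obtain ⟨t, ht, ht'⟩ := ih.2 _ rfl
            exact ⟨t, .head (b := (q', u')) ⟨h, h'⟩ ht, ht'⟩
    exact (key _ h).1 rfl
  · intro h
    induction h using ReflTransGen.head_induction_on with
    | refl => exact .refl
    | @head u u' h _ ih =>
      have e1 : ReflTransGen (C.loop.Step Op.Rel) (some C.start, u) (some C.last, u') :=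
        ReflTransGen.lift (r := C.Step Op.Rel) (p := C.loop.Step Op.Rel)
          (fun c : C.Node × (ℕ → ℕ) => ((some c.1, c.2) : C.loop.Node × (ℕ → ℕ)))
          (fun _ _ h => h) _ _ ((hC _ _).2 h)
      have e : C.loop.Step Op.Rel (none, u) (some C.start, u) := ⟨rfl, rfl⟩
      have e' : C.loop.Step Op.Rel (some C.last, u') (none, u') :=
        ⟨by change (C.op C.last).Rel u' u'; rw [C.op_last]; rfl, rfl⟩
      exact .head e (e1.trans (.head e' ih))

theorem Prog.exists_chart {R} (hR : Prog R) : ∃ C : Chart, C.Defines R := by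
  induction hR with
  | op o => exact ⟨_, Chart.single_defines o⟩
  | comp _ _ ih ih' =>
    obtain ⟨C, hC⟩ := ih
    obtain ⟨D, hD⟩ := ih'
    exact ⟨_, Chart.seq_defines hC hD⟩
  | star _ ih =>
    obtain ⟨C, hC⟩ := ih
    exact ⟨_, Chart.loop_defines hC⟩

/-! ### Instructions as arithmetic on Gödel numbers. -/

/-- Multiplier, divisor, and the data of a test on the remainder modulo a number. -/
structure Arith where
  mul : ℕ
  div : ℕ
  modulus : ℕ
  lo : ℕ
  hi : ℕ

/-- The remainder of `y` lies between `lo` and `hi`, and `y` is multiplied with the fraction. -/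
def Arith.Rel (d : Arith) (y y' : ℕ) : Prop :=
  (d.lo ≤ y % d.modulus ∧ y % d.modulus ≤ d.hi) ∧ y' * d.div = y * d.mul

/-- The prime number whose exponent stores register `i`. -/
noncomputable def base (i : ℕ) : ℕ :=
  Nat.nth Nat.Prime i

theorem prime_base (i : ℕ) : (base i).Prime :=
  Nat.prime_nth_prime i

theorem base_injective : Injective base :=
  Nat.nth_injective Nat.infinite_setOfPred_prime

/-- The instructions as operations on the Gödel number of the registers. -/
noncomputable def Op.arith : Op → Arith
  -- With modulus `1` and range `0` to `0` the test always succeeds.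
  | .nop => ⟨1, 1, 1, 0, 0⟩
  | .inc i => ⟨base i, 1, 1, 0, 0⟩
  | .dec i => ⟨1, base i, base i, 0, 0⟩
  | .zero i => ⟨1, 1, base i, 1, base i - 1⟩

theorem Op.arith_pos (o : Op) : 0 < o.arith.mul ∧ 0 < o.arith.div ∧ 0 < o.arith.modulus ∧
    o.arith.hi < o.arith.modulus := by
  cases o <;> simp [Op.arith, (prime_base _).pos]

/-- The automaton divides real numbers and cannot see whether the quotient is integral; the test
guarantees it. -/
theorem Op.arith_dvd {o : Op} {y : ℕ}
    (h : o.arith.lo ≤ y % o.arith.modulus ∧ y % o.arith.modulus ≤ o.arith.hi) :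
    o.arith.div ∣ y * o.arith.mul := by
  cases o with
  | dec i => simpa [Op.arith, Nat.dvd_iff_mod_eq_zero] using h
  | _ => exact one_dvd _

/-- The registers with Gödel number `y`. -/
noncomputable def regs (y : ℕ) : ℕ → ℕ :=
  fun i => y.factorization (base i)

theorem factorization_base (i j : ℕ) :
    (base i).factorization (base j) = if j = i then 1 else 0 := by
  rw [(prime_base i).factorization, Finsupp.single_apply]
  simp [base_injective.eq_iff, eq_comm]

theorem regs_mul_base {y : ℕ} (hy : 0 < y) (i : ℕ) :
    regs (y * base i) = update (regs y) i (regs y i + 1) := by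
  ext j
  simp only [regs, Nat.factorization_mul hy.ne' (prime_base i).ne_zero, Finsupp.add_apply,
    factorization_base, update_apply]
  split_ifs with h
  · rw [h]
  · rfl

theorem regs_ne_zero_iff {y : ℕ} (hy : 0 < y) (i : ℕ) : regs y i ≠ 0 ↔ base i ∣ y :=
  ⟨fun h => Nat.dvd_of_factorization_pos h,
    fun h => ((prime_base i).factorization_pos_of_dvd hy.ne' h).ne'⟩

theorem regs_of_mul_base {y y' : ℕ} (hy' : 0 < y') {i : ℕ} (h : y' * base i = y) :
    regs y i ≠ 0 ∧ regs y' = update (regs y) i (regs y i - 1) := by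
  subst h
  rw [regs_mul_base hy']
  simp

theorem Op.arith_rel_pos {o : Op} {y y' : ℕ} (hy : 0 < y) (h : o.arith.Rel y y') : 0 < y' := by
  refine Nat.pos_of_ne_zero fun h0 => ?_
  have := h.2
  rw [h0, zero_mul] at this
  exact (Nat.mul_pos hy o.arith_pos.1).ne this

theorem Op.zero_test {y i : ℕ} (hy : 0 < y) :
    (1 ≤ y % base i ∧ y % base i ≤ base i - 1) ↔ regs y i = 0 := by
  have := Nat.mod_lt y (prime_base i).pos
  rw [← not_iff_not, ← ne_eq, regs_ne_zero_iff hy, Nat.dvd_iff_mod_eq_zero]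
  omega

theorem Op.rel_of_arith {o : Op} {y y' : ℕ} (hy : 0 < y) (h : o.arith.Rel y y') :
    o.Rel (regs y) (regs y') := by
  have hy' := Op.arith_rel_pos hy h
  obtain ⟨h, e⟩ := h
  cases o with
  | nop =>
    obtain rfl : y' = y := by simpa [Op.arith] using e
    rfl
  | inc i =>
    obtain rfl : y' = y * base i := by simpa [Op.arith] using e
    exact regs_mul_base hy i
  | dec i => exact regs_of_mul_base hy' (by simpa [Op.arith] using e)
  | zero i =>
    obtain rfl : y' = y := by simpa [Op.arith] using e
    exact ⟨(Op.zero_test hy).1 h, rfl⟩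

theorem Op.arith_of_rel {o : Op} {y : ℕ} (hy : 0 < y) {s' : ℕ → ℕ} (h : o.Rel (regs y) s') :
    ∃ y', o.arith.Rel y y' ∧ regs y' = s' := by
  cases o with
  | nop =>
    refine ⟨y, ?_, h.symm⟩
    simp [Op.arith, Arith.Rel, Nat.mod_one]
  | inc i =>
    refine ⟨y * base i, ?_, ?_⟩
    · simp [Op.arith, Arith.Rel, Nat.mod_one]
    · rw [regs_mul_base hy, h]
  | dec i =>
    obtain ⟨h, rfl⟩ := h
    obtain ⟨z, hz⟩ := (regs_ne_zero_iff hy i).1 h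
    have hz0 : 0 < z := Nat.pos_of_ne_zero fun h0 => by simp [hz, h0] at hy
    refine ⟨z, ?_, (regs_of_mul_base hz0 (by rw [hz, mul_comm])).2⟩
    simp [Op.arith, Arith.Rel, hz, mul_comm]
  | zero i =>
    obtain ⟨h, rfl⟩ := h
    exact ⟨y, ⟨(Op.zero_test hy).2 h, rfl⟩, rfl⟩

theorem regs_two_pow (n : ℕ) : regs (2 ^ n) = update (fun _ => 0) 0 n := by
  have h2 : base 0 = 2 := Nat.nth_prime_zero_eq_two
  ext i
  rw [regs, ← h2, Nat.factorization_pow, Finsupp.smul_apply, factorization_base, update_apply]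
  split_ifs <;> simp

/-- One step of a flow chart on Gödel numbers. -/
def Chart.ArithStep (C : Chart) : C.Node × ℕ → C.Node × ℕ → Prop :=
  C.Step fun o => o.arith.Rel

/-- `regs` is a bisimulation between positive numbers and register contents. Positivity is preserved
and is needed because `0` has no prime factorization. -/
theorem Chart.exists_arithStep_iff {C : Chart} {R} (hC : C.Defines R) {y : ℕ} (hy : 0 < y) :
    (∃ y', ReflTransGen C.ArithStep (C.start, y) (C.last, y')) ↔ ∃ s', R (regs y) s' := by
  constructor
  · rintro ⟨y', h⟩
    have key : ∀ c : C.Node × ℕ, ReflTransGen C.ArithStep (C.start, y) c →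
        0 < c.2 ∧ ReflTransGen (C.Step Op.Rel) (C.start, regs y) (c.1, regs c.2) := by
      intro c hc
      induction hc with
      | refl => exact ⟨hy, .refl⟩
      | tail _ h ih =>
        exact ⟨Op.arith_rel_pos ih.1 h.1, ih.2.tail ⟨Op.rel_of_arith ih.1 h.1, h.2⟩⟩
    exact ⟨_, (hC _ _).1 (key _ h).2⟩
  · rintro ⟨s', h⟩
    have key : ∀ c : C.Node × (ℕ → ℕ), ReflTransGen (C.Step Op.Rel) (C.start, regs y) c →
        ∃ z, 0 < z ∧ regs z = c.2 ∧ ReflTransGen C.ArithStep (C.start, y) (c.1, z) := by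
      intro c hc
      induction hc with
      | refl => exact ⟨y, hy, rfl, .refl⟩
      | tail _ h ih =>
        obtain ⟨z, hz, e, hr⟩ := ih
        obtain ⟨h, h'⟩ := h
        rw [← e] at h
        obtain ⟨z', hz', e'⟩ := Op.arith_of_rel hz h
        exact ⟨z', Op.arith_rel_pos hz hz', e', hr.tail ⟨hz', h'⟩⟩
    obtain ⟨z, -, -, hz⟩ := key _ ((hC _ _).2 h)
    exact ⟨z, hz⟩

theorem exists_chart_of_partrec {f : ℕ →. ℕ} (hf : Partrec f) : ∃ C : Chart, ∀ n,
    (∃ y', ReflTransGen C.ArithStep (C.start, 2 ^ n) (C.last, y')) ↔ (f n).Dom := by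
  obtain ⟨R, hR, h⟩ := exists_prog_of_partrec hf
  obtain ⟨C, hC⟩ := hR.exists_chart
  refine ⟨C, fun n => ?_⟩
  rw [Chart.exists_arithStep_iff hC (by positivity), regs_two_pow, h]

end Register

/-! ### Runs and the semantics of `EX` and `EU`. -/

namespace Hybrid

namespace SHA

variable {M A X P : Type} [Fintype X] {H : SHA M A X} {L : M → Finset P} {φ ψ : CTL P}
  {c c' : State M X} {t : ℝ} {a : A}

/-- The run that starts with an additional step. -/
def Run.cons (r : H.Run) (h : H.Step c t a (r.conf 0)) : H.Run where
  conf
    | 0 => c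
    | i + 1 => r.conf i
  delay
    | 0 => t
    | i + 1 => r.delay i
  act
    | 0 => a
    | i + 1 => r.act i
  step
    | 0 => h
    | i + 1 => r.step i

theorem Run.NonZeno.cons {r : H.Run} (hr : r.NonZeno) (h : H.Step c t a (r.conf 0)) :
    (r.cons h).NonZeno :=
  fun hs => hr ((summable_nat_add_iff 1).2 hs)

/-- The run without its first step. -/
def Run.tail (r : H.Run) : H.Run where
  conf i := r.conf (i + 1)
  delay i := r.delay (i + 1)
  act i := r.act (i + 1)
  step i := r.step (i + 1)

theorem Run.NonZeno.tail {r : H.Run} (hr : r.NonZeno) : r.tail.NonZeno :=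
  fun hs => hr ((summable_nat_add_iff 1).1 hs)

/-- Some non-Zeno run starts from the configuration. -/
def Live (H : SHA M A X) (c : State M X) : Prop :=
  ∃ r : H.Run, r.conf 0 = c ∧ r.NonZeno

/-- Adding or removing one step does not affect divergence of the delays, so non-Zenoness concerns
only the successor. -/
theorem sat_EX_iff : H.Sat L (.EX φ) c ↔ ∃ t a c', H.Step c t a c' ∧ H.Live c' ∧ H.Sat L φ c' := by
  constructor
  · rintro ⟨r, rfl, hr, h⟩
    exact ⟨_, _, _, r.step 0, ⟨r.tail, rfl, hr.tail⟩, h⟩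
  · rintro ⟨t, a, c', hs, ⟨r, rfl, hr⟩, h⟩
    exact ⟨r.cons hs, rfl, hr.cons hs, h⟩

theorem live_of_sat_EU (h : H.Sat L (.EU φ ψ) c) : H.Live c := by
  obtain ⟨r, h, hr, -⟩ := h
  exact ⟨r, h, hr⟩

theorem live_of_sat_EX (h : H.Sat L (.EX φ) c) : H.Live c := by
  obtain ⟨r, h, hr, -⟩ := h
  exact ⟨r, h, hr⟩

theorem sat_EU_of_sat (hc : H.Live c) (h : H.Sat L ψ c) : H.Sat L (.EU φ ψ) c := by
  obtain ⟨r, rfl, hr⟩ := hc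
  exact ⟨r, rfl, hr, 0, h, by simp⟩

theorem sat_EU_of_step (h : H.Sat L φ c) (hs : H.Step c t a c') (h' : H.Sat L (.EU φ ψ) c') :
    H.Sat L (.EU φ ψ) c := by
  obtain ⟨r, rfl, hr, i, hi, hj⟩ := h'
  refine ⟨r.cons hs, rfl, hr.cons hs, i + 1, hi, fun j hji => ?_⟩
  cases j with
  | zero => exact h
  | succ j => exact hj j (by omega)

theorem sat_or_of_sat_EU (h : H.Sat L (.EU φ ψ) c) : H.Sat L φ c ∨ H.Sat L ψ c := by
  obtain ⟨r, rfl, -, i, hi, hj⟩ := h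
  cases i with
  | zero => exact .inr hi
  | succ i => exact .inl (hj 0 (by omega))

theorem sat_EU_induction {p : State M X → Prop} (h0 : ∀ c, H.Sat L ψ c → p c)
    (h1 : ∀ c t a c', H.Sat L φ c → H.Step c t a c' → H.Sat L (.EU φ ψ) c' → p c' → p c)
    (h : H.Sat L (.EU φ ψ) c) : p c := by
  obtain ⟨r, rfl, hr, i, hi, hj⟩ := h
  induction i generalizing r with
  | zero => exact h0 _ hi
  | succ i ih =>
    exact h1 _ _ _ _ (hj 0 (by omega)) (r.step 0)
      ⟨r.tail, rfl, hr.tail, i, hi, fun j h => hj (j + 1) (by omega)⟩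
      (ih r.tail hr.tail hi fun j h => hj (j + 1) (by omega))

end SHA

/-- A linear constraint for two variables. -/
def constraint (a b : ℤ) (r : Rel) (k : ℤ) : LinConstraint (Fin 2) :=
  ⟨![a, b], r, k⟩

theorem constraint_holds {a b : ℤ} {r : Rel} {k : ℤ} {x y : ℝ} :
    (constraint a b r k).Holds ![x, y] ↔ r.Holds (a * x + b * y) k := by
  simp [LinConstraint.Holds, constraint]

end Hybrid

/-! ### The automaton of a flow chart. -/

namespace Register

open Hybrid

/-- The modes of the automaton for a flow chart: a mode and a test mode for every node, and a
sink. -/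
abbrev Chart.Mode (C : Chart) : Type :=
  C.Node ⊕ C.Node ⊕ Unit

namespace Chart

variable (C : Chart)

/-- The rate of the second variable. -/
noncomputable def rate : C.Mode → ℤ
  | .inl q => (C.op q).arith.mul - (C.op q).arith.div
  | .inr (.inl q) => -(C.op q).arith.modulus
  | .inr (.inr _) => 0

open Classical in
/-- The guard of the transition between two modes, and whether it resets the clock. From `(0, y)`,
the mode of a node leads to another node with `(0, y * mul / div)`; its test mode subtracts the
modulus repeatedly and leads to the sink if the remainder is in the range. -/
noncomputable def edge : C.Mode → C.Mode → Option (Hybrid.Poly (Fin 2) × Bool)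
  -- The guard is `y = mul * x`. With the rate `mul - div` it holds at time `t` exactly if the
  -- initial value of `y` was `t * div`; then the current value is `t * mul`.
  | .inl p, .inl q =>
    if C.next p q then some ([constraint (-(C.op p).arith.mul) 1 .eq 0], true) else none
  -- The guard `x = 0` forbids any delay, so the test receives `y` unchanged.
  | .inl p, .inr (.inl q) => if p = q then some ([constraint 1 0 .eq 0], false) else none
  | .inr (.inl p), .inr (.inl q) => if p = q then some ([constraint 1 0 .eq 1], true) else none
  | .inr (.inl p), .inr (.inr _) =>
    some ([constraint 1 0 .eq 0, constraint 0 1 .ge (C.op p).arith.lo,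
      constraint 0 1 .le (C.op p).arith.hi], false)
  | .inr (.inr _), .inr (.inr _) => some ([constraint 1 0 .eq 1], true)
  | _, _ => none

/-- The number of modes. -/
abbrev size : ℕ :=
  Fintype.card C.Mode

/-- The numbering of the modes. -/
noncomputable def code : C.Mode ≃ Fin C.size :=
  Fintype.equivFin _

/-- The transition between two modes. -/
noncomputable def transition (m m' : C.Mode) (g : Hybrid.Poly (Fin 2) × Bool) :
    Transition (Fin C.size) (Fin (C.size * C.size)) (Fin 2) where
  src := C.code m
  guard := g.1
  -- Between two modes there is at most one transition, so the pair of modes can serve as its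
  -- action.
  act := finProdFinEquiv (C.code m, C.code m')
  reset := cond g.2 {0} ∅
  tgt := C.code m'

/-- The list of all transitions. -/
noncomputable def transitions :
    List (Transition (Fin C.size) (Fin (C.size * C.size)) (Fin 2)) :=
  (Finset.univ : Finset (C.Mode × C.Mode)).toList.flatMap fun m =>
    (C.edge m.1 m.2).toList.map (C.transition m.1 m.2)

theorem mem_transitions {δ} :
    δ ∈ C.transitions ↔ ∃ m m' g, C.edge m m' = some g ∧ δ = C.transition m m' g := by
  simp [transitions, eq_comm]

/-- The automaton that simulates the flow chart. -/
noncomputable def aut : SHA (Fin C.size) (Fin (C.size * C.size)) (Fin 2) where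
  init := {C.code (.inl C.start)}
  trans := C.transitions
  inv _ := []
  flow m := ![1, C.rate (C.code.symm m)]
  act_unique := by
    intro δ hδ δ' hδ' h
    obtain ⟨m, m', g, hg, rfl⟩ := C.mem_transitions.1 hδ
    obtain ⟨l, l', g', hg', rfl⟩ := C.mem_transitions.1 hδ'
    have := finProdFinEquiv.injective h
    obtain ⟨h1, h2⟩ := Prod.mk.inj this
    obtain rfl := C.code.injective h1
    obtain rfl := C.code.injective h2
    obtain rfl := Option.some.inj (hg.symm.trans hg')
    rfl

/-- The configuration in a mode with given values of the clock and the other variable. -/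
noncomputable def conf (m : C.Mode) (x y : ℝ) : State (Fin C.size) (Fin 2) :=
  (C.code m, ![x, y])

variable {C}

theorem after_conf (m : C.Mode) (x y t : ℝ) :
    C.aut.after (C.code m) ![x, y] t = ![x + t, y + t * C.rate m] := by
  ext i
  fin_cases i <;> simp [SHA.after, aut]

theorem exists_step_iff {m : C.Mode} {x y t : ℝ} {c' : State (Fin C.size) (Fin 2)} :
    (∃ a, C.aut.Step (C.conf m x y) t a c') ↔ 0 ≤ t ∧ ∃ m' g, C.edge m m' = some g ∧
      ![x + t, y + t * C.rate m] ∈ g.1.sem ∧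
      c' = C.conf m' (if g.2 then 0 else x + t) (y + t * C.rate m) := by
  have hr : ∀ (b : Bool) (u v : ℝ), (fun i => if i ∈ (cond b {0} ∅ : Finset (Fin 2)) then 0
      else ![u, v] i) = ![if b then 0 else u, v] := by
    intro b u v
    ext i
    fin_cases i <;> cases b <;> simp
  have hinv : ∀ c, C.aut.IsConfig c := fun c g hg => absurd hg List.not_mem_nil
  constructor
  · rintro ⟨a, ht, -, -, δ, hδ, h1, -, h3, -, h5, h6⟩
    obtain ⟨m₀, m', g, hg, rfl⟩ := C.mem_transitions.1 hδ
    obtain rfl := C.code.injective h1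
    refine ⟨ht, m', g, hg, ?_, ?_⟩
    · rw [← after_conf]
      exact h5
    · refine Prod.ext h3.symm (h6.trans ?_)
      simp only [conf]
      rw [← hr, ← after_conf]
      ext i
      simp only [transition]
      congr
  · rintro ⟨ht, m', g, hg, h, rfl⟩
    refine ⟨_, ht, hinv _, hinv _, _, C.mem_transitions.2 ⟨m, m', g, hg, rfl⟩, rfl, rfl, rfl,
      fun τ _ g hg => absurd hg List.not_mem_nil, ?_, ?_⟩
    · rw [← after_conf] at h
      exact h
    · simp only [conf]
      rw [← hr, ← after_conf]
      ext i
      simp only [transition]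
      congr

/-- There is a step, with some delay and action, between the configurations. -/
def Move (C : Chart) (c c' : State (Fin C.size) (Fin 2)) : Prop :=
  ∃ t a, C.aut.Step c t a c'

theorem move_iff {m : C.Mode} {x y : ℝ} {c' : State (Fin C.size) (Fin 2)} :
    C.Move (C.conf m x y) c' ↔ ∃ t, 0 ≤ t ∧ ∃ m' g, C.edge m m' = some g ∧
      ![x + t, y + t * C.rate m] ∈ g.1.sem ∧
      c' = C.conf m' (if g.2 then 0 else x + t) (y + t * C.rate m) :=
  exists_congr fun _ => exists_step_iff

/-- The new value `y'` is only known to be real here. Nonnegativity of `y` makes the delay `y / div`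
admissible. -/
theorem move_node_iff {q : C.Node} {y : ℝ} (hy : 0 ≤ y) {c' : State (Fin C.size) (Fin 2)} :
    C.Move (C.conf (.inl q) 0 y) c' ↔
      (∃ q', C.next q q' ∧ ∃ y', y' * (C.op q).arith.div = y * (C.op q).arith.mul ∧
        c' = C.conf (.inl q') 0 y') ∨ c' = C.conf (.inr (.inl q)) 0 y := by
  have hdiv : (0 : ℝ) < (C.op q).arith.div := by exact_mod_cast (C.op q).arith_pos.2.1
  rw [move_iff]
  constructor
  · rintro ⟨t, ht, m', g, hg, h, rfl⟩
    rcases m' with q' | q' | ⟨⟩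
    · left
      simp only [edge, Option.ite_none_right_eq_some] at hg
      obtain ⟨hn, hg⟩ := hg
      obtain rfl := Option.some.inj hg
      refine ⟨q', hn, _, ?_, rfl⟩
      have h := h _ (List.mem_singleton_self _)
      rw [constraint_holds] at h
      simp only [Rel.Holds, rate] at h ⊢
      push_cast at h ⊢
      have e : y = t * (C.op q).arith.div := by linarith
      rw [e]
      ring
    · right
      simp only [edge, Option.ite_none_right_eq_some] at hg
      obtain ⟨rfl, hg⟩ := hg
      obtain rfl := Option.some.inj hg
      have h := h _ (List.mem_singleton_self _)
      rw [constraint_holds] at h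
      simp only [Rel.Holds] at h
      push_cast at h
      obtain rfl : t = 0 := by linarith
      simp
    · cases hg
  · rintro (⟨q', hn, y', e, rfl⟩ | rfl)
    · have e' : y' = y / (C.op q).arith.div * (C.op q).arith.mul := by
        rw [div_mul_eq_mul_div, ← e, mul_div_cancel_right₀ _ hdiv.ne']
      have e'' : y = y / (C.op q).arith.div * (C.op q).arith.div :=
        (div_mul_cancel₀ _ hdiv.ne').symm
      have e3 : y + y / (C.op q).arith.div * C.rate (.inl q) = y' := by
        rw [e', rate]
        nth_rw 1 [e'']
        push_cast
        ring
      refine ⟨y / (C.op q).arith.div, by positivity, .inl q', _, if_pos hn, ?_, ?_⟩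
      · intro g hg
        obtain rfl := List.mem_singleton.1 hg
        rw [constraint_holds, e3, e']
        simp only [Rel.Holds]
        push_cast
        ring
      · rw [e3]
        simp
    · refine ⟨0, le_rfl, .inr (.inl q), _, if_pos rfl, ?_, ?_⟩
      · intro g hg
        obtain rfl := List.mem_singleton.1 hg
        simp [constraint_holds, Rel.Holds]
      · simp

theorem move_test_iff {q : C.Node} {y : ℝ} {c' : State (Fin C.size) (Fin 2)} :
    C.Move (C.conf (.inr (.inl q)) 0 y) c' ↔
      c' = C.conf (.inr (.inl q)) 0 (y - (C.op q).arith.modulus) ∨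
      ((C.op q).arith.lo ≤ y ∧ y ≤ (C.op q).arith.hi) ∧ c' = C.conf (.inr (.inr ())) 0 y := by
  rw [move_iff]
  constructor
  · rintro ⟨t, ht, m', g, hg, h, rfl⟩
    rcases m' with q' | q' | ⟨⟩
    · cases hg
    · left
      simp only [edge, Option.ite_none_right_eq_some] at hg
      obtain ⟨rfl, hg⟩ := hg
      obtain rfl := Option.some.inj hg
      have h := h _ (List.mem_singleton_self _)
      rw [constraint_holds] at h
      simp only [Rel.Holds] at h
      push_cast at h
      obtain rfl : t = 1 := by linarith
      simp [rate, sub_eq_add_neg]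
    · right
      obtain rfl := Option.some.inj hg
      have h1 := h _ (.head _)
      have h2 := h _ (.tail _ (.head _))
      have h3 := h _ (.tail _ (.tail _ (.head _)))
      rw [constraint_holds] at h1 h2 h3
      simp only [Rel.Holds] at h1 h2 h3
      push_cast at h1 h2 h3
      obtain rfl : t = 0 := by linarith
      refine ⟨⟨by linarith, by linarith⟩, by simp⟩
  · rintro (rfl | ⟨⟨h1, h2⟩, rfl⟩)
    · refine ⟨1, zero_le_one, .inr (.inl q), _, if_pos rfl, ?_, ?_⟩
      · intro g hg
        obtain rfl := List.mem_singleton.1 hg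
        simp [constraint_holds, Rel.Holds]
      · simp [rate, sub_eq_add_neg]
    · refine ⟨0, le_rfl, .inr (.inr ()), _, rfl, ?_, ?_⟩
      · intro g hg
        simp only [List.mem_cons, List.not_mem_nil, or_false] at hg
        rcases hg with rfl | rfl | rfl <;> rw [constraint_holds] <;>
          simp [Rel.Holds, h1, h2]
      · simp

/-- All non-Zeno continuations needed later come from this loop with constant delay `1`. -/
theorem live_sink (y : ℝ) : C.aut.Live (C.conf (.inr (.inr ())) 0 y) := by
  have h : ∃ a, C.aut.Step (C.conf (.inr (.inr ())) 0 y) 1 a (C.conf (.inr (.inr ())) 0 y) := by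
    rw [exists_step_iff]
    refine ⟨zero_le_one, .inr (.inr ()), _, rfl, ?_, ?_⟩
    · intro g hg
      obtain rfl := List.mem_singleton.1 hg
      simp [constraint_holds, Rel.Holds]
    · simp [rate]
  obtain ⟨a, ha⟩ := h
  refine ⟨⟨fun _ => _, fun _ => 1, fun _ => a, fun _ => ha⟩, rfl, ?_⟩
  simp [SHA.Run.NonZeno, summable_const_iff]

/-! ### The formulas and their meaning in the automaton. -/

variable (C)

open Classical in
/-- The atomic propositions: `0` for nodes, `1` for test modes, `2` for the sink, and `3` for the
last node. -/
noncomputable def label (m : Fin C.size) : Finset (Fin 4) :=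
  match C.code.symm m with
  | .inl q => if q = C.last then {0, 3} else {0}
  | .inr (.inl _) => {1}
  | .inr (.inr _) => {2}

/-- The test of the current node can be passed. -/
def testFormula : CTL (Fin 4) :=
  .EX (.EU (.atom 1) (.atom 2))

/-- Some run passes all its tests and reaches the last node. -/
def haltFormula : CTL (Fin 4) :=
  .EU (.and (.atom 0) testFormula) (.atom 3)

variable {C}

theorem sat_atom {i : Fin 4} {m : C.Mode} {x y : ℝ} :
    C.aut.Sat C.label (.atom i) (C.conf m x y) ↔ i ∈ C.label (C.code m) :=
  Iff.rfl

theorem label_node (q : C.Node) : C.label (C.code (.inl q)) = {0} ∨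
    q = C.last ∧ C.label (C.code (.inl q)) = {0, 3} := by
  by_cases h : q = C.last <;> simp [label, h]

theorem label_last : C.label (C.code (.inl C.last)) = {0, 3} := by
  simp [label]

theorem label_test (q : C.Node) : C.label (C.code (.inr (.inl q))) = {1} := by
  simp [label]

theorem label_sink : C.label (C.code (.inr (.inr ()))) = {2} := by
  simp [label]

/-- The number `k` counts the rounds of the unit-time loop before the exit to the sink. -/
theorem sat_EU_test_iff {q : C.Node} {y : ℝ} :
    C.aut.Sat C.label (.EU (.atom 1) (.atom 2)) (C.conf (.inr (.inl q)) 0 y) ↔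
      ∃ k : ℕ, (C.op q).arith.lo ≤ y - k * (C.op q).arith.modulus ∧
        y - k * (C.op q).arith.modulus ≤ (C.op q).arith.hi := by
  constructor
  · intro h
    refine SHA.sat_EU_induction (p := fun c => ∀ y, c = C.conf (.inr (.inl q)) 0 y →
      ∃ k : ℕ, (C.op q).arith.lo ≤ y - k * (C.op q).arith.modulus ∧
        y - k * (C.op q).arith.modulus ≤ (C.op q).arith.hi) ?_ ?_ h y rfl
    · rintro _ h y rfl
      rw [sat_atom, label_test] at h
      simp at h
    · rintro _ t a c' - hs - ih y rfl
      rcases move_test_iff.1 ⟨t, a, hs⟩ with rfl | ⟨h, rfl⟩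
      · obtain ⟨k, hk⟩ := ih _ rfl
        refine ⟨k + 1, ?_⟩
        push_cast
        rwa [add_one_mul, add_comm, ← sub_sub]
      · exact ⟨0, by simpa using h⟩
  · rintro ⟨k, hk⟩
    have hq : ∀ y, C.aut.Sat C.label (.atom 1) (C.conf (.inr (.inl q)) 0 y) := fun y => by
      rw [sat_atom, label_test]
      simp
    induction k generalizing y with
    | zero =>
      obtain ⟨t, a, h⟩ := move_test_iff.2 (.inr ⟨by simpa using hk, rfl⟩)
      refine SHA.sat_EU_of_step (hq _) h (SHA.sat_EU_of_sat (live_sink y) ?_)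
      rw [sat_atom, label_sink]
      simp
    | succ k ih =>
      obtain ⟨t, a, h⟩ := move_test_iff.2 (.inl rfl)
      refine SHA.sat_EU_of_step (hq _) h (ih ?_)
      push_cast at hk
      rwa [add_one_mul, add_comm, ← sub_sub] at hk

/-- As `lo` is nonnegative and `hi` is below the modulus, only the quotient can serve as `k`.
Subtracting too often therefore cannot fake a success. -/
theorem exists_sub_mul_iff {d : Arith} (hd : d.hi < d.modulus) {n : ℕ} :
    (∃ k : ℕ, (d.lo : ℝ) ≤ n - k * d.modulus ∧ (n : ℝ) - k * d.modulus ≤ d.hi) ↔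
      d.lo ≤ n % d.modulus ∧ n % d.modulus ≤ d.hi := by
  constructor
  · rintro ⟨k, h1, h2⟩
    have h1' : d.lo + k * d.modulus ≤ n := by
      have : ((d.lo + k * d.modulus : ℕ) : ℝ) ≤ n := by push_cast; linarith
      exact_mod_cast this
    have h2' : n ≤ d.hi + k * d.modulus := by
      have : (n : ℝ) ≤ (d.hi + k * d.modulus : ℕ) := by push_cast; linarith
      exact_mod_cast this
    obtain ⟨r, rfl⟩ := Nat.exists_eq_add_of_le' (le_of_add_le_right h1')
    rw [Nat.add_mul_mod_self_right, Nat.mod_eq_of_lt (by omega)]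
    omega
  · intro h
    have e : (n : ℝ) - (n / d.modulus : ℕ) * d.modulus = (n % d.modulus : ℕ) := by
      rw [sub_eq_iff_eq_add]
      exact_mod_cast (Nat.mod_add_div' n d.modulus).symm
    refine ⟨n / d.modulus, ?_⟩
    rw [e]
    exact_mod_cast h

theorem sat_testFormula_iff {q : C.Node} {n : ℕ} :
    C.aut.Sat C.label testFormula (C.conf (.inl q) 0 n) ↔
      (C.op q).arith.lo ≤ n % (C.op q).arith.modulus ∧
        n % (C.op q).arith.modulus ≤ (C.op q).arith.hi := by
  rw [← exists_sub_mul_iff (C.op q).arith_pos.2.2.2, ← sat_EU_test_iff, testFormula,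
    SHA.sat_EX_iff]
  constructor
  · rintro ⟨t, a, c', hs, -, h⟩
    rcases (move_node_iff n.cast_nonneg).1 ⟨t, a, hs⟩ with ⟨q', -, y', -, rfl⟩ | rfl
    · have := SHA.sat_or_of_sat_EU h
      -- A successor that is a node has neither proposition `1` nor `2`, so the step must have
      -- entered the test mode.
      rw [sat_atom, sat_atom] at this
      rcases label_node q' with e | ⟨-, e⟩ <;> rw [e] at this <;> simp at this
    · exact h
  · intro h
    obtain ⟨t, a, hs⟩ := (move_node_iff (C := C) (q := q) n.cast_nonneg).2 (.inr rfl)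
    exact ⟨t, a, _, hs, SHA.live_of_sat_EU h, h⟩

theorem sat_haltFormula_iff {q : C.Node} {n : ℕ} (hn : 0 < n) :
    C.aut.Sat C.label haltFormula (C.conf (.inl q) 0 n) ↔
      ∃ n', ReflTransGen C.ArithStep (q, n) (C.last, n') := by
  constructor
  · intro h
    refine SHA.sat_EU_induction (p := fun c => ∀ q (n : ℕ), 0 < n → c = C.conf (.inl q) 0 n →
      ∃ n', ReflTransGen C.ArithStep (q, n) (C.last, n')) ?_ ?_ h q n hn rfl
    · rintro _ h q n - rfl
      rw [sat_atom] at h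
      rcases label_node q with e | ⟨rfl, -⟩
      · rw [e] at h
        simp at h
      · exact ⟨n, .refl⟩
    · rintro _ t a c' ⟨-, ht⟩ hs h' ih q n hn rfl
      rw [sat_testFormula_iff] at ht
      rcases (move_node_iff n.cast_nonneg).1 ⟨t, a, hs⟩ with ⟨q', hq, y', hy, rfl⟩ | rfl
      · obtain ⟨n', hn'⟩ := Op.arith_dvd ht
        rw [mul_comm _ n'] at hn'
        have hdiv : ((C.op q).arith.div : ℝ) ≠ 0 :=
          Nat.cast_ne_zero.2 (C.op q).arith_pos.2.1.ne'
        obtain rfl : y' = n' := by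
          refine mul_right_cancel₀ hdiv (hy.trans ?_)
          exact_mod_cast hn'
        have hr : (C.op q).arith.Rel n n' := ⟨ht, hn'.symm⟩
        obtain ⟨k, hk⟩ := ih q' n' (Op.arith_rel_pos hn hr) rfl
        exact ⟨k, .head ⟨hr, hq⟩ hk⟩
      · rcases SHA.sat_or_of_sat_EU h' with ⟨h, -⟩ | h <;> rw [sat_atom, label_test] at h <;>
          simp at h
  · rintro ⟨n', h⟩
    have key : ∀ c : C.Node × ℕ, ReflTransGen C.ArithStep c (C.last, n') → 0 < c.2 →
        C.aut.Sat C.label haltFormula (C.conf (.inl c.1) 0 c.2) := by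
      intro c hc
      induction hc using ReflTransGen.head_induction_on with
      | refl =>
        intro _
        -- The last node carries `nop`, so its test succeeds and leads to the sink; this gives the
        -- non-Zeno run that `EU` requires.
        refine SHA.sat_EU_of_sat (SHA.live_of_sat_EX (sat_testFormula_iff.2 ?_)) ?_
        · simp [C.op_last, Op.arith, Nat.mod_one]
        · rw [sat_atom, label_last]
          simp
      | @head c c' h _ ih =>
        intro hc
        obtain ⟨h, h'⟩ := h
        have hc' := Op.arith_rel_pos hc h
        obtain ⟨t, a, hs⟩ := (move_node_iff (C := C) (q := c.1) c.2.cast_nonneg).2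
          (.inl ⟨c'.1, h', (c'.2 : ℝ), by exact_mod_cast h.2, rfl⟩)
        refine SHA.sat_EU_of_step ⟨?_, sat_testFormula_iff.2 h.1⟩ hs (ih hc')
        rw [sat_atom]
        rcases label_node c.1 with e | ⟨-, e⟩ <;> rw [e] <;> simp
    exact key _ h hn

/-! ### The reduction from the halting problem. -/

/-- The model-checking instance with starting valuation `(0, 2 ^ n)`. -/
noncomputable def mcInstance (C : Chart) (n : ℕ) : MCInstance 2 where
  numModes := C.size
  numActs := C.size * C.size
  numProps := 4
  aut := C.aut
  start := ![0, (2 ^ n : ℕ)]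
  lab := C.label
  formula := haltFormula
  start_config _ _ _ hg := absurd hg List.not_mem_nil

theorem mcInstance_isClock (n : ℕ) : (C.mcInstance n).aut.IsClock (0 : Fin 2) :=
  fun _ => rfl

theorem mcInstance_holds_iff (n : ℕ) : (C.mcInstance n).Holds ↔
    ∃ n', ReflTransGen C.ArithStep (C.start, 2 ^ n) (C.last, n') := by
  rw [← sat_haltFormula_iff (by positivity)]
  have e : (fun i => ((![0, ((2 ^ n : ℕ) : ℚ)] i : ℚ) : ℝ)) = ![0, ((2 ^ n : ℕ) : ℝ)] := by
    ext i
    fin_cases i <;> simp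
  have : (C.mcInstance n).Holds ↔ ∀ m ∈ ({C.code (.inl C.start)} : Finset _),
      C.aut.Sat C.label haltFormula (m, fun i => ((![0, ((2 ^ n : ℕ) : ℚ)] i : ℚ) : ℝ)) := Iff.rfl
  rw [this, e]
  simp only [Finset.mem_singleton, forall_eq]
  rfl

theorem codeRat_natCast (n : ℕ) : codeRat (n : ℚ) = ((false, n), 1) := by
  have : ¬ ((n : ℤ) < 0) := by omega
  simp only [codeRat, codeInt, Rat.num_natCast, Rat.den_natCast, Int.natAbs_natCast, this,
    decide_false]

/-- Everything except the starting valuation is a constant once `C` is fixed, so it does not matter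
that the automaton is built by noncomputable choices. -/
theorem computable_code (C : Chart) : Computable fun n => (C.mcInstance n).code := by
  have hp : Primrec fun n : ℕ => 2 ^ n := by
    refine (Primrec.nat_rec₁ 1 (f := fun _ m => m * 2) ?_).of_eq fun n => ?_
    · exact Primrec.nat_mul.comp Primrec.snd (Primrec.const 2)
    · induction n with
      | zero => rfl
      | succ n ih => rw [pow_succ, ← ih]
  have hs : Primrec fun n : ℕ => [codeRat 0, (((false, 2 ^ n), 1) : RatCode)] :=
    Primrec.list_cons.comp (Primrec.const _) (Primrec.list_cons.comp
      (((Primrec.const false).pair hp).pair (Primrec.const 1)) (Primrec.const []))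
  have h : Primrec fun n : ℕ => (((C.size, C.size * C.size, 4), codeSHA C.aut,
      [codeRat 0, ((false, 2 ^ n), 1)], List.ofFn fun m => codeFinset (C.label m),
      codeCTL haltFormula) : MCCode) :=
    (Primrec.const _).pair ((Primrec.const _).pair (hs.pair
      ((Primrec.const _).pair (Primrec.const _))))
  refine h.to_comp.of_eq fun n => ?_
  rw [← codeRat_natCast]
  rfl

end Chart

end Register

/-- CTL model checking is undecidable for singular hybrid automata with two variables, one of which
is a clock. -/
theorem theorem2 :
    ¬ Hybrid.DecidableOn (fun I : Hybrid.MCInstance 2 => I.code)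
        (fun I => ∃ y, I.aut.IsClock y) (fun I => I.Holds) := by
  rintro ⟨f, hf, h⟩
  -- This function is universal: its domain consists of the codes of programs that halt on input
  -- `0`. One chart thus serves for all programs.
  have hu : Partrec fun n : ℕ => (Nat.Partrec.Code.ofNatCode n).eval 0 :=
    Nat.Partrec.Code.eval_part.comp (Computable.ofNat _) (Computable.const 0)
  obtain ⟨C, hC⟩ := Register.exists_chart_of_partrec hu
  refine ComputablePred.halting_problem 0 (ComputablePred.computable_iff.2
    ⟨fun c => f (C.mcInstance (Encodable.encode c)).code,
      hf.comp (C.computable_code.comp Computable.encode), funext fun c => propext ?_⟩)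
  refine Iff.trans ?_ (h _ ⟨_, Register.Chart.mcInstance_isClock _⟩).symm
  refine Iff.trans ?_ (Register.Chart.mcInstance_holds_iff _).symm
  rw [hC]
  have : Nat.Partrec.Code.ofNatCode (Encodable.encode c) = c := Denumerable.ofNat_encode c
  rw [this]
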